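/- Let $p$ be a prime and let $|\cdot|_p$ be the $p$-adic absolute value, extended to $\overline{\mathbb{Q}}_p$. **Notation.** For a letter $a$ let $A_a=\begin{pmatrix}0&1\\1&a\end{pmatrix}$; for a finite word $u=a_1\cdots a_n$ let $A_u=A_{a_1}\cdots A_{a_n}$ (the identity for the empty word). For an infinite word $w=a_1a_2\cdots$ let $w_n$ be its prefix of length $n$, let $\mathrm{T}$ be the left shift, and for $\mathbf{q}\in\mathbf{P}^1_{\mathbb{Q}_p}$ put $\mathrm{T}(w,\mathbf{q})=(\mathrm{T}w,A_{a_1}\mathbf{q})$. For $\epsilon>0$, $\mathbf{PBad}_\epsilon$ is the set of $(q_1:q_2)\in\mathbf{P}^1_{\mathbb{Q}_p}$ such that $$|aq_1+bq_2|_p\cdot\min\{|q_1|_p^{-1},|q_2|_p^{-1}\}\ \ge\ \epsilon\cdot\min\{|a|^{-2},|b|^{-2}\}\qquad\text{for all }(a,b)\in\mathbb{Z}^2\setminus\{(0,0)\}$$ (with $|0|^{-1}=\infty$), and $\mathbf{LMad}$ is the set of pairs $(w,\mathbf{x}_p)$ for which there is $\epsilon>0$ such that $\mathrm{T}^n(w,\mathbf{x}_p)\in\{1,\dots,N\}^{\mathbb{N}}\times\mathbf{PBad}_\epsilon$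 for all $n\ge 0$, where $N=\lfloor\epsilon^{-1}\rfloor+1$. Let $V(n,w)=\{A_{w_m}: m\ge 0,\ w_n\text{ is a prefix of }\mathrm{T}^mw\}$, and let $V_p(w)=\bigcap_{n\ge1}\overline{V(n,w)}$, the closures being taken in the $2\times2$ matrices over $\mathbb{Z}_p$. Let $\widetilde{\mathrm{SL}}_2(\mathbb{Z}_p)$ be the set of $2\times 2$ matrices $A$ over $\mathbb{Z}_p$ with $\det A=\pm1$ that have two different eigenvectors in $\mathbf{P}^1_{\overline{\mathbb{Q}}_p}$ and satisfy $\log(\lambda^{\kappa(A)})\ne0$ for each eigenvalue $\lambda$. Here $\log x=\sum_{n\ge1}(-1)^{n-1}(x-1)^n/n$ is the $p$-adic logarithm, and $\kappa(A)$ is the least positive integer $k$ with $|\lambda^{k}-1|_p\le p^{-1}$ for each eigenvalue $\lambda$ of $A$. **Theorem.** Let $w$ be an infinite word and let $A\in\widetilde{\mathrm{SL}}_2(\mathbb{Z}_p)$ be an element of $V_p(w)$. Then $A^T$ has exactly two eigenvectors $\mathbf{w}_1\neq\mathbf{w}_2$ in $\mathbf{P}^1_{\overline{\mathbb{Q}}_p}$,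 and $(w,\mathbf{x}_p)\in\mathbf{LMad}$ is possible only for $\mathbf{x}_p=\mathbf{w}_1$ or $\mathbf{x}_p=\mathbf{w}_2$. In particular there are at most two points $\mathbf{x}_p\in\mathbf{P}^1_{\mathbb{Q}_p}$ with $(w,\mathbf{x}_p)\in\mathbf{LMad}$. Any such $\mathbf{x}_p$ has the form $(\xi:1)$ with $\xi\in\mathbb{Q}_p\setminus\mathbb{Q}$ algebraic of degree at most $2$ over the field generated over $\mathbb{Q}$ by the entries of $A$; if the entries of $A$ are rational, then $\xi$ is a quadratic irrational, that is, algebraic of degree exactly $2$ over $\mathbb{Q}$. -/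

import Mathlib

namespace PadicLittlewood

/-- The matrix `A_a = (0 1; 1 a)` attached to a letter `a`. -/
def letterMat (a : ℕ) : Matrix (Fin 2) (Fin 2) ℤ := !![0, 1; 1, a]

/-- The matrix `A_u = A_{a₁} ⋯ A_{aₙ}` of a finite word `u = a₁ … aₙ`; it is the identity for the
empty word. -/
def wordMat (u : List ℕ) : Matrix (Fin 2) (Fin 2) ℤ := (u.map letterMat).prod

/-- The prefix `w_n` of length `n` of an infinite word `w = w 0, w 1, …`. -/
def wordPrefix (w : ℕ → ℕ) (n : ℕ) : List ℕ := (List.range n).map w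

/-- The left shift on infinite words, iterated `m` times. -/
def shift (m : ℕ) (w : ℕ → ℕ) : ℕ → ℕ := fun i => w (m + i)

/-- The alphabet `{1, …, N}`; `wordsOver N` is the set of infinite words over it. -/
def wordsOver (N : ℕ) : Set (ℕ → ℕ) := {w | ∀ i, 1 ≤ w i ∧ w i ≤ N}

/-- A point of the projective line is an eigenvector of `M`. -/
def IsEigenpoint {K : Type*} [Field K] (M : Matrix (Fin 2) (Fin 2) K)
    (v : Projectivization K (Fin 2 → K)) : Prop :=
  ∃ μ : K, M.mulVec v.rep = μ • v.rep

theorem isEigenpoint_mk {K : Type*} [Field K] (M : Matrix (Fin 2) (Fin 2) K)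
    (v : Fin 2 → K) (hv : v ≠ 0) :
    IsEigenpoint M (Projectivization.mk K v hv) ↔ ∃ μ : K, M.mulVec v = μ • v := by
  obtain ⟨a, ha⟩ := Projectivization.exists_smul_eq_mk_rep K v hv
  unfold IsEigenpoint
  rw [← ha]
  refine exists_congr fun μ => ?_
  rw [Matrix.mulVec_smul, smul_comm μ a v]
  exact smul_left_cancel_iff a

section

variable (p : ℕ) [Fact p.Prime]

theorem letterMat_injective (a : ℕ) :
    Function.Injective (((letterMat a).map (Int.cast : ℤ → ℚ_[p])).mulVecLin) := by
  rw [Matrix.coe_mulVecLin]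
  apply Matrix.mulVec_injective_of_isUnit
  rw [Matrix.isUnit_iff_isUnit_det]
  simp [letterMat, Matrix.det_fin_two]

/-- The action of `A_a` on the projective line over `ℚ_p`. -/
noncomputable def letterAct (a : ℕ) :
    Projectivization ℚ_[p] (Fin 2 → ℚ_[p]) → Projectivization ℚ_[p] (Fin 2 → ℚ_[p]) :=
  Projectivization.map ((letterMat a).map (Int.cast : ℤ → ℚ_[p])).mulVecLin
    (letterMat_injective p a)

/-- The extension `T (w, q) = (T w, A_{a₁} q)`, with `a₁` the first letter of `w`, of the left shift
to pairs. -/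
noncomputable def shiftPair (x : (ℕ → ℕ) × Projectivization ℚ_[p] (Fin 2 → ℚ_[p])) :
    (ℕ → ℕ) × Projectivization ℚ_[p] (Fin 2 → ℚ_[p]) :=
  (shift 1 x.1, letterAct p (x.1 0) x.2)

/-- The points `(q₁ : q₂)` of the projective line over `ℚ_p` with
`|a q₁ + b q₂| · min (|q₁|⁻¹, |q₂|⁻¹) ≥ ε · min (|a|⁻², |b|⁻²)` for all integers `(a, b) ≠ (0, 0)`,
where `|0|⁻¹ = ∞`; the denominators are cleared. The condition does not depend on the choice of
homogeneous coordinates, see `mk_mem_PBadEps`. -/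
def PBadEps (ε : ℝ) : Set (Projectivization ℚ_[p] (Fin 2 → ℚ_[p])) :=
  {q | ∀ a b : ℤ, (a, b) ≠ (0, 0) →
    ε * max ‖q.rep 0‖ ‖q.rep 1‖ ≤
      ‖(a : ℚ_[p]) * q.rep 0 + (b : ℚ_[p]) * q.rep 1‖ * max |(a : ℝ)| |(b : ℝ)| ^ 2}

theorem mk_mem_PBadEps (ε : ℝ) (v : Fin 2 → ℚ_[p]) (hv : v ≠ 0) :
    Projectivization.mk ℚ_[p] v hv ∈ PBadEps p ε ↔ ∀ a b : ℤ, (a, b) ≠ (0, 0) →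
      ε * max ‖v 0‖ ‖v 1‖ ≤
        ‖(a : ℚ_[p]) * v 0 + (b : ℚ_[p]) * v 1‖ * max |(a : ℝ)| |(b : ℝ)| ^ 2 := by
  obtain ⟨c, hc⟩ := Projectivization.exists_smul_eq_mk_rep ℚ_[p] v hv
  have hc0 : 0 < ‖(c : ℚ_[p])‖ := norm_pos_iff.mpr c.ne_zero
  unfold PBadEps
  rw [Set.mem_ofPred_eq, ← hc]
  refine forall_congr' fun a => forall_congr' fun b => imp_congr_right fun _ => ?_
  have h1 : (a : ℚ_[p]) * (c • v) 0 + (b : ℚ_[p]) * (c • v) 1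
      = (c : ℚ_[p]) * ((a : ℚ_[p]) * v 0 + (b : ℚ_[p]) * v 1) := by
    simp only [Pi.smul_apply, Units.smul_def, smul_eq_mul]; ring
  have h2 : max ‖(c • v) 0‖ ‖(c • v) 1‖ = ‖(c : ℚ_[p])‖ * max ‖v 0‖ ‖v 1‖ := by
    simp only [Pi.smul_apply, Units.smul_def, smul_eq_mul, norm_mul]
    rw [mul_max_of_nonneg _ _ hc0.le]
  rw [h1, h2, norm_mul, mul_left_comm, mul_assoc, mul_le_mul_iff_right₀ hc0]

/-- The pairs `(w, x)` all of whose iterates under `T` lie in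
`{1, …, N}^ℕ × PBadEps`, where `N = ⌊ε⁻¹⌋ + 1`. -/
def LMadEps (ε : ℝ) : Set ((ℕ → ℕ) × Projectivization ℚ_[p] (Fin 2 → ℚ_[p])) :=
  {x | ∀ n : ℕ, ((shiftPair p)^[n] x).1 ∈ wordsOver (⌊ε⁻¹⌋₊ + 1) ∧
    ((shiftPair p)^[n] x).2 ∈ PBadEps p ε}

/-- The set `LMad`, the union of the sets `LMadEps` over all `ε > 0`. -/
def LMad : Set ((ℕ → ℕ) × Projectivization ℚ_[p] (Fin 2 → ℚ_[p])) :=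
  {x | ∃ ε : ℝ, 0 < ε ∧ x ∈ LMadEps p ε}

/-- `V(n, w)`: the matrices `A_{w_m}`, `m ≥ 0`, such that `w_n` is a prefix of `T^m w`. -/
def V (n : ℕ) (w : ℕ → ℕ) : Set (Matrix (Fin 2) (Fin 2) ℤ) :=
  {M | ∃ m : ℕ, wordPrefix (shift m w) n = wordPrefix w n ∧ M = wordMat (wordPrefix w m)}

/-- `V(n, w)`, considered as a set of matrices over `ℤ_p`. -/
def VpLevel (n : ℕ) (w : ℕ → ℕ) : Set (Matrix (Fin 2) (Fin 2) ℤ_[p]) :=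
  (fun M : Matrix (Fin 2) (Fin 2) ℤ => M.map (Int.cast : ℤ → ℤ_[p])) '' V n w

/-- `V_p(w)`: the intersection over `n ≥ 1` of the closures of `V(n, w)` in the `p`-adic
topology. -/
def Vp (w : ℕ → ℕ) : Set (Matrix (Fin 2) (Fin 2) ℤ_[p]) :=
  ⋂ n ∈ Set.Ici 1, closure (VpLevel p n w)

/-- A matrix over `ℤ_p`, considered over the algebraic closure of `ℚ_p`. -/
noncomputable def toAlgCl (A : Matrix (Fin 2) (Fin 2) ℤ_[p]) :
    Matrix (Fin 2) (Fin 2) (PadicAlgCl p) :=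
  A.map fun z => algebraMap ℚ_[p] (PadicAlgCl p) (z : ℚ_[p])

/-- `SL₂^±(ℤ_p)`: the matrices of determinant `±1`. -/
def SLpm : Set (Matrix (Fin 2) (Fin 2) ℤ_[p]) := {A | A.det = 1 ∨ A.det = -1}

/-- `SL^±_{2,1}(ℤ_p)`: the matrices in `SL₂^±(ℤ_p)` with two different eigenvectors in the
projective line over the algebraic closure of `ℚ_p`. -/
def SLpmOne : Set (Matrix (Fin 2) (Fin 2) ℤ_[p]) :=
  {A | A ∈ SLpm p ∧ ∃ v₁ v₂ : Projectivization (PadicAlgCl p) (Fin 2 → PadicAlgCl p),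
    v₁ ≠ v₂ ∧ IsEigenpoint (toAlgCl p A) v₁ ∧ IsEigenpoint (toAlgCl p A) v₂}

/-- The `p`-adic logarithm `log x = ∑_{n ≥ 1} (-1)^(n-1) (x - 1)^n / n`. The series converges for
`‖x - 1‖ < 1`, as it takes place in the complete field `ℚ_p(x)`. The index is shifted by one. -/
noncomputable def padicLog (x : PadicAlgCl p) : PadicAlgCl p :=
  ∑' n : ℕ, (-1) ^ n * (x - 1) ^ (n + 1) / ((n + 1 : ℕ) : PadicAlgCl p)

/-- `κ(A)`: the least positive integer `k` with `‖λ^k - 1‖ ≤ p⁻¹` for each eigenvalue `λ` of `A`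
(for `A ∈ SL^±_{2,1}(ℤ_p)` there is one). -/
noncomputable def kappa (A : Matrix (Fin 2) (Fin 2) ℤ_[p]) : ℕ :=
  sInf {k : ℕ | 0 < k ∧ ∀ μ : PadicAlgCl p,
    Module.End.HasEigenvalue (Matrix.toLin' (toAlgCl p A)) μ → ‖μ ^ k - 1‖ ≤ (p : ℝ)⁻¹}

/-- The matrices `A ∈ SL^±_{2,1}(ℤ_p)` such that `log (λ^κ(A)) ≠ 0` for each eigenvalue `λ`. -/
def SLtilde : Set (Matrix (Fin 2) (Fin 2) ℤ_[p]) :=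
  {A | A ∈ SLpmOne p ∧ ∀ μ : PadicAlgCl p,
    Module.End.HasEigenvalue (Matrix.toLin' (toAlgCl p A)) μ → padicLog p (μ ^ kappa p A) ≠ 0}

/-- Coordinatewise inclusion of `ℚ_p²` into the plane over the algebraic closure of `ℚ_p`. -/
noncomputable def planeToAlgCl :
    (Fin 2 → ℚ_[p]) →ₛₗ[algebraMap ℚ_[p] (PadicAlgCl p)] (Fin 2 → PadicAlgCl p) where
  toFun v := fun i => algebraMap ℚ_[p] (PadicAlgCl p) (v i)
  map_add' u v := by ext i; simp
  map_smul' c v := by ext i; simp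

theorem planeToAlgCl_injective : Function.Injective (planeToAlgCl p) := by
  intro u v h
  ext i
  exact (algebraMap ℚ_[p] (PadicAlgCl p)).injective (congrFun h i)

/-- The inclusion of the projective line over `ℚ_p` into the one over the algebraic closure. -/
noncomputable def pointToAlgCl (x : Projectivization ℚ_[p] (Fin 2 → ℚ_[p])) :
    Projectivization (PadicAlgCl p) (Fin 2 → PadicAlgCl p) :=
  Projectivization.map (planeToAlgCl p) (planeToAlgCl_injective p) x

/-- The affine coordinate `ξ = x₁ / x₂` of a point `(x₁ : x₂)` (meaningful if `x₂ ≠ 0`). -/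
noncomputable def affineCoord (x : Projectivization ℚ_[p] (Fin 2 → ℚ_[p])) : ℚ_[p] :=
  x.rep 0 / x.rep 1

/-- The subfield of `ℚ_p` generated by the entries of `A`. -/
noncomputable def entryField (A : Matrix (Fin 2) (Fin 2) ℤ_[p]) : IntermediateField ℚ ℚ_[p] :=
  IntermediateField.adjoin ℚ {z : ℚ_[p] | ∃ i j, z = (A i j : ℚ_[p])}

end

end PadicLittlewood

open PadicLittlewood

open PadicLittlewood

namespace PadicLittlewood

open Filter Topology

/-! Let `(w, x)` lie in `LMad` with constant ε and let v represent x. Letter matrices are symmetric,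
so the n-th iterate of T moves v by the transpose of the n-th prefix matrix, and all these vectors
lie in the closed cone over `PBadEps`. Every power of A is a limit of prefix matrices
(`pow_mem_closure_VpLevel`), so the cone contains every (Aᵀ)^k v.

Some positive power of Aᵀ is 1 + D with D divisible by p². Write (1 + D)^t = α_t + β_t D. Then t ↦
β_t/α_t is a p-adic isometry from ℕ to ℤ_p and has dense image, so the cone contains v + r D v for
all r in ℤ_p (`add_smul_mem_of_isClosed`). If v and D v were independent, this disc would contain a
nonzero vector killed by an integral linear form, which badness forbids
(`mul_eq_mul_of_add_smul_mem_badCone`). Hence v is an eigenvector of (Aᵀ)^k.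

By Cayley–Hamilton A^k = a + bA. If b = 0, the eigenvalues of A are roots of unity, whose logarithms
vanish, contrary to the assumption on A (`pow_ne_smul_one`). So v is an eigenvector of Aᵀ itself.
The eigenvector equation is a nontrivial equation of degree at most 2 for ξ, and badness excludes
rational ξ. -/

/-! ### The p-adic logarithm vanishes at roots of unity. -/

theorem tendsto_choose_pow_mul_sub_one (p : ℕ) [Fact p.Prime] {n : ℕ} (hn : n ≠ 0) (k : ℕ) :
    Tendsto (fun r : ℕ => (((p ^ r * n - 1).choose k : ℕ) : ℤ_[p])) atTop (𝓝 ((-1) ^ k)) := by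
  have hlim : Tendsto (fun r : ℕ => ((p : ℤ_[p]) ^ r * n - 1)) atTop (𝓝 (-1)) := by
    have h : Tendsto (fun r : ℕ => (p : ℤ_[p]) ^ r) atTop (𝓝 0) :=
      tendsto_pow_atTop_nhds_zero_of_norm_lt_one (by
        simpa using inv_lt_one_of_one_lt₀
          (show (1 : ℝ) < p from mod_cast (Fact.out : p.Prime).one_lt))
    simpa using (h.mul_const (n : ℤ_[p])).sub_const 1
  -- Binomial coefficients are continuous in their upper argument on ℤ_p, and p^r n - 1 tends to -1.
  have h := ((PadicInt.continuous_choose (p := p) k).tendsto (-1)).comp hlim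
  have hone : Ring.choose (-1 : ℤ_[p]) k = (-1) ^ k := by
    rw [Ring.choose_neg', Ring.multichoose_one]
    simp [Int.negOnePow_def, Units.smul_def]
  rw [hone] at h
  refine h.congr fun r => ?_
  have hpos : 1 ≤ p ^ r * n :=
    Nat.one_le_iff_ne_zero.mpr (mul_ne_zero (pow_ne_zero _ (Fact.out : p.Prime).ne_zero) hn)
  rw [← Ring.choose_natCast, Nat.cast_sub hpos]
  simp

/-- Absorption, (m + 1) C(m, k) = (k + 1) C(m + 1, k + 1), turns the sum into a binomial expansion.
With m + 1 = p^r n these sums approximate the logarithm of 1 + x, and they vanish when (1 + x)^n =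
1. -/
theorem sum_choose_mul_pow_div {K : Type*} [Field K] [CharZero K] (x : K) (m : ℕ) :
    ∑ k ∈ Finset.range (m + 1), (m.choose k : K) * x ^ (k + 1) / ((k + 1 : ℕ) : K)
      = ((1 + x) ^ (m + 1) - 1) / ((m + 1 : ℕ) : K) := by
  have hm : ((m + 1 : ℕ) : K) ≠ 0 := Nat.cast_ne_zero.mpr m.succ_ne_zero
  rw [eq_div_iff hm, Finset.sum_mul, add_comm 1 x, add_pow, Finset.sum_range_succ' _ (m + 1)]
  simp only [one_pow, mul_one, pow_zero, Nat.choose_zero_right, Nat.cast_one, add_sub_cancel_right]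
  refine Finset.sum_congr rfl fun k _ => ?_
  have hk : ((k + 1 : ℕ) : K) ≠ 0 := Nat.cast_ne_zero.mpr k.succ_ne_zero
  have h : ((m + 1 : ℕ) : K) * (m.choose k : K) =
      ((m + 1).choose (k + 1) : K) * ((k + 1 : ℕ) : K) := by
    exact_mod_cast Nat.add_one_mul_choose_eq m k
  rw [div_mul_eq_mul_div, div_eq_iff hk]
  linear_combination x ^ (k + 1) * h

theorem norm_natCast_inv_le (p : ℕ) [Fact p.Prime] {k : ℕ} (hk : k ≠ 0) : ‖(k : ℚ_[p])‖⁻¹ ≤ k := by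
  rw [Padic.norm_eq_zpow_neg_valuation (Nat.cast_ne_zero.mpr hk), Padic.valuation_natCast,
    zpow_neg, inv_inv, zpow_natCast]
  exact_mod_cast Nat.le_of_dvd (Nat.pos_of_ne_zero hk) pow_padicValNat_dvd

theorem summable_succ_mul_inv_pow (p : ℕ) [Fact p.Prime] :
    Summable fun k : ℕ => ((k + 1 : ℕ) : ℝ) * ((p : ℝ)⁻¹) ^ (k + 1) := by
  have h : ‖(p : ℝ)⁻¹‖ < 1 := by
    rw [norm_inv, Real.norm_natCast]
    exact inv_lt_one_of_one_lt₀ (by exact_mod_cast (Fact.out : p.Prime).one_lt)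
  have := summable_pow_mul_geometric_of_norm_lt_one 1 h
  simpa using (summable_nat_add_iff 1).mpr this

theorem tsum_log_eq_zero_of_pow_eq_one (p : ℕ) [Fact p.Prime] (μ : ℂ_[p]) {n : ℕ} (hn : n ≠ 0)
    (hμ : μ ^ n = 1) (h1 : ‖μ - 1‖ ≤ (p : ℝ)⁻¹) :
    ∑' k : ℕ, (-1) ^ k * (μ - 1) ^ (k + 1) / ((k + 1 : ℕ) : ℂ_[p]) = 0 := by
  set x := μ - 1 with hx
  let f : ℕ → ℕ → ℂ_[p] := fun r k =>
    ((p ^ r * n - 1).choose k : ℂ_[p]) * x ^ (k + 1) / ((k + 1 : ℕ) : ℂ_[p])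
  have hnorm : ∀ m : ℕ, ‖(m : ℂ_[p])‖ = ‖(m : ℚ_[p])‖ := fun m => by
    rw [← PadicComplex.norm_extends' p (m : ℚ_[p])]; simp
  have hf : ∀ r, ∑' k, f r k = 0 := fun r => by
    have hpos : 1 ≤ p ^ r * n :=
      Nat.one_le_iff_ne_zero.mpr (mul_ne_zero (pow_ne_zero _ (Fact.out : p.Prime).ne_zero) hn)
    rw [tsum_eq_sum (s := Finset.range (p ^ r * n - 1 + 1)), sum_choose_mul_pow_div,
      Nat.sub_add_cancel hpos, hx, add_sub_cancel, mul_comm, pow_mul, hμ]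
    · simp
    · intro k hk
      have : p ^ r * n - 1 < k := by simpa using hk
      simp [f, Nat.choose_eq_zero_of_lt this]
  have hlim : Tendsto (fun r => ∑' k, f r k) atTop
      (𝓝 (∑' k : ℕ, (-1) ^ k * x ^ (k + 1) / ((k + 1 : ℕ) : ℂ_[p]))) := by
    -- The bound (k + 1) p^(-(k+1)) is uniform in r: binomial coefficients have norm at most 1, and
    -- 1/(k + 1) has norm at most k + 1.
    refine tendsto_tsum_of_dominated_convergence (summable_succ_mul_inv_pow p) (fun k => ?_) ?_
    · have hc : Continuous fun z : ℤ_[p] => algebraMap ℚ_[p] ℂ_[p] (z : ℚ_[p]) :=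
        (continuous_algebraMap ℚ_[p] ℂ_[p]).comp continuous_subtype_val
      have := (hc.tendsto _).comp (tendsto_choose_pow_mul_sub_one p hn k)
      have h2 : Tendsto (fun r : ℕ => ((p ^ r * n - 1).choose k : ℂ_[p])) atTop (𝓝 ((-1) ^ k)) := by
        simpa [Function.comp_def] using this
      exact (h2.mul_const _).div_const _
    · refine Eventually.of_forall fun r k => ?_
      have hc : ‖((p ^ r * n - 1).choose k : ℂ_[p])‖ ≤ 1 := by
        rw [hnorm]; exact_mod_cast Padic.norm_int_le_one (p := p) _
      rw [norm_div, norm_mul, norm_pow, hnorm (k + 1), div_eq_mul_inv, mul_comm]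
      refine mul_le_mul (norm_natCast_inv_le p k.succ_ne_zero) ?_ (by positivity) (by positivity)
      calc _ ≤ 1 * ((p : ℝ)⁻¹) ^ (k + 1) := by gcongr
        _ = _ := one_mul _
  simp only [hf] at hlim
  exact (tendsto_nhds_unique hlim tendsto_const_nhds)

theorem padicLog_eq_zero_of_pow_eq_one (p : ℕ) [Fact p.Prime] (μ : PadicAlgCl p) {n : ℕ}
    (hn : n ≠ 0) (hμ : μ ^ n = 1) (h1 : ‖μ - 1‖ ≤ (p : ℝ)⁻¹) : padicLog p μ = 0 := by
  unfold padicLog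
  by_cases hs : Summable fun n : ℕ =>
      (-1) ^ n * (μ - 1) ^ (n + 1) / ((n + 1 : ℕ) : PadicAlgCl p)
  · have h := tsum_log_eq_zero_of_pow_eq_one p (algebraMap (PadicAlgCl p) ℂ_[p] μ) hn
      (by rw [← map_pow, hμ, map_one])
      (by rw [← map_one (algebraMap (PadicAlgCl p) ℂ_[p]), ← map_sub, norm_algebraMap']; exact h1)
    apply (algebraMap (PadicAlgCl p) ℂ_[p]).injective
    rw [map_zero, ← h]
    refine (hs.map_tsum (algebraMap (PadicAlgCl p) ℂ_[p])
      (continuous_algebraMap _ _)).trans (tsum_congr fun k => ?_)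
    simp
  -- A series that is not summable has default sum 0, so no convergence proof in the incomplete
  -- field is needed.
  · exact tsum_eq_zero_of_not_summable hs

/-! ### Powers of 1 + D and their coefficients. -/

/-- The coefficients `(α, β)` of `(1 + D) ^ t = α + β D` if `D ^ 2 = τ D - δ`. -/
def powCoeff {R : Type*} [CommRing R] (τ δ : R) : ℕ → R × R
  | 0 => (1, 0)
  | t + 1 => ((powCoeff τ δ t).1 - δ * (powCoeff τ δ t).2,
      (powCoeff τ δ t).1 + (powCoeff τ δ t).2 + τ * (powCoeff τ δ t).2)

theorem sq_eq_trace_smul_sub_det {R : Type*} [CommRing R] (D : Matrix (Fin 2) (Fin 2) R) :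
    D * D = D.trace • D - D.det • 1 := by
  ext i j
  fin_cases i <;> fin_cases j <;>
    simp [Matrix.mul_apply, Matrix.trace_fin_two, Matrix.det_fin_two, Fin.sum_univ_two] <;> ring

theorem one_add_pow_eq {R : Type*} [CommRing R] (D : Matrix (Fin 2) (Fin 2) R) (t : ℕ) :
    (1 + D) ^ t = (powCoeff D.trace D.det t).1 • 1 + (powCoeff D.trace D.det t).2 • D := by
  induction t with
  | zero => simp [powCoeff]
  | succ t ih =>
    rw [pow_succ, ih, powCoeff]
    simp only [mul_add, add_mul, smul_mul_assoc, one_mul, mul_one, sq_eq_trace_smul_sub_det]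
    module

section

variable {R : Type*} [CommRing R] (τ δ : R)

/-- This is the product (α_s + β_s D)(α_t + β_t D) reduced by D² = τD - δ. -/
theorem powCoeff_add (s t : ℕ) :
    (powCoeff τ δ (s + t)).1 =
      (powCoeff τ δ s).1 * (powCoeff τ δ t).1 - δ * (powCoeff τ δ s).2 * (powCoeff τ δ t).2 ∧
    (powCoeff τ δ (s + t)).2 =
      (powCoeff τ δ s).1 * (powCoeff τ δ t).2 + (powCoeff τ δ s).2 * (powCoeff τ δ t).1 +
        τ * (powCoeff τ δ s).2 * (powCoeff τ δ t).2 := by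
  induction t with
  | zero => simp [powCoeff]
  | succ t ih =>
    rw [← add_assoc, powCoeff, powCoeff, ih.1, ih.2]
    constructor <;> ring

variable {τ δ}

theorem dvd_powCoeff_fst_sub_one {q : R} (hδ : q ∣ δ) (t : ℕ) :
    q ∣ (powCoeff τ δ t).1 - 1 := by
  induction t with
  | zero => simp [powCoeff]
  | succ t ih =>
    have : (powCoeff τ δ (t + 1)).1 - 1 =
        ((powCoeff τ δ t).1 - 1) - δ * (powCoeff τ δ t).2 := by rw [powCoeff]; ring
    rw [this]
    exact dvd_sub ih (hδ.mul_right _)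

/-- Modulo q every α is 1 and τ, δ vanish, so β is additive to first order. The case j = p drives
the induction in `norm_powCoeff_snd`. -/
theorem exists_powCoeff_snd_mul {q : R} (hτ : q ∣ τ) (hδ : q ∣ δ) (m j : ℕ) :
    ∃ c : R, (powCoeff τ δ (m * j)).2 = (powCoeff τ δ m).2 * c ∧ q ∣ c - j := by
  induction j with
  | zero => exact ⟨0, by simp [powCoeff], by simp⟩
  | succ j ih =>
    obtain ⟨c, hc, hd⟩ := ih
    refine ⟨(powCoeff τ δ (m * j)).1 + c * (powCoeff τ δ m).1 + τ * (powCoeff τ δ (m * j)).2,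
      ?_, ?_⟩
    · rw [mul_add, mul_one, (powCoeff_add τ δ (m * j) m).2, hc]
      ring
    · have : (powCoeff τ δ (m * j)).1 + c * (powCoeff τ δ m).1 + τ * (powCoeff τ δ (m * j)).2 -
          ((j + 1 : ℕ) : R) = ((powCoeff τ δ (m * j)).1 - 1) + c * ((powCoeff τ δ m).1 - 1) +
            (c - j) + τ * (powCoeff τ δ (m * j)).2 := by push_cast; ring
      rw [this]
      exact dvd_add (dvd_add (dvd_add (dvd_powCoeff_fst_sub_one hδ _)
        ((dvd_powCoeff_fst_sub_one hδ _).mul_left _)) hd) (hτ.mul_right _)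

end

section

variable {p : ℕ} [Fact p.Prime] {τ δ : ℤ_[p]}

/-- An error divisible by p² is smaller than anything of norm at least 1/p. This is why D is taken
divisible by p² and not just by p: the factor p itself must keep its norm. -/
theorem norm_eq_norm_of_sq_dvd_sub {x y : ℤ_[p]} (h : (p : ℤ_[p]) ^ 2 ∣ x - y)
    (hy : (p : ℝ)⁻¹ ≤ ‖y‖) : ‖x‖ = ‖y‖ := by
  have hp : (1 : ℝ) < p := mod_cast (Fact.out : p.Prime).one_lt
  have h1 : ‖x - y‖ < ‖y‖ := by
    obtain ⟨c, hc⟩ := h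
    refine lt_of_lt_of_le ?_ hy
    rw [hc, norm_mul, norm_pow, PadicInt.norm_p]
    have h2 : ((p : ℝ)⁻¹) ^ 2 < (p : ℝ)⁻¹ :=
      pow_lt_self_of_lt_one₀ (by positivity) (inv_lt_one_of_one_lt₀ hp) one_lt_two
    exact lt_of_le_of_lt (mul_le_of_le_one_right (by positivity) (PadicInt.norm_le_one c)) h2
  have := IsUltrametricDist.norm_add_eq_max_of_norm_ne_norm h1.ne
  rwa [sub_add_cancel, max_eq_right h1.le] at this

theorem norm_powCoeff_fst (hδ : (p : ℤ_[p]) ^ 2 ∣ δ) (t : ℕ) : ‖(powCoeff τ δ t).1‖ = 1 := by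
  rw [norm_eq_norm_of_sq_dvd_sub (dvd_powCoeff_fst_sub_one hδ t), norm_one]
  rw [norm_one]
  exact inv_le_one_of_one_le₀ (mod_cast (Fact.out : p.Prime).one_lt.le)

theorem norm_powCoeff_snd (hτ : (p : ℤ_[p]) ^ 2 ∣ τ) (hδ : (p : ℤ_[p]) ^ 2 ∣ δ) (t : ℕ) :
    ‖(powCoeff τ δ t).2‖ = ‖(t : ℤ_[p])‖ := by
  induction t using Nat.strong_induction_on with
  | _ t ih =>
    rcases Nat.eq_zero_or_pos t with rfl | ht
    · simp [powCoeff]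
    by_cases hpt : p ∣ t
    · obtain ⟨m, rfl⟩ := hpt
      have hm : m < p * m := by
        have := (Fact.out : p.Prime).one_lt
        have : 0 < m := Nat.pos_of_mul_pos_left ht
        nlinarith
      obtain ⟨c, hc, hd⟩ := exists_powCoeff_snd_mul hτ hδ m p
      rw [mul_comm p m, hc, norm_mul, ih m hm,
        norm_eq_norm_of_sq_dvd_sub hd PadicInt.norm_p.ge, Nat.cast_mul, norm_mul]
    · obtain ⟨c, hc, hd⟩ := exists_powCoeff_snd_mul hτ hδ 1 t
      have hone : (powCoeff τ δ 1).2 = 1 := by simp [powCoeff]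
      have hn : ‖(t : ℤ_[p])‖ = 1 := by
        rw [PadicInt.norm_natCast_eq_one_iff]
        exact (Nat.Prime.coprime_iff_not_dvd Fact.out).mpr hpt
      rw [one_mul, hone, one_mul] at hc
      rw [hc, norm_eq_norm_of_sq_dvd_sub hd]
      rw [hn]
      exact inv_le_one_of_one_le₀ (mod_cast (Fact.out : p.Prime).one_lt.le)

/-- An isometry from `ℕ` with the `p`-adic metric to `ℤ_p` has dense image. -/
theorem exists_norm_sub_le_of_isometry {f : ℕ → ℤ_[p]}
    (hf : ∀ s t : ℕ, ‖f (s + t) - f s‖ = ‖(t : ℤ_[p])‖) (r : ℤ_[p]) (n : ℕ) :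
    ∃ t : ℕ, ‖f t - r‖ ≤ (p : ℝ) ^ (-n : ℤ) := by
  have key : ∀ x : ℤ_[p], PadicInt.toZModPow n x = 0 ↔ ‖x‖ ≤ (p : ℝ) ^ (-n : ℤ) := fun x => by
    rw [PadicInt.norm_le_pow_iff_mem_span_pow, ← PadicInt.ker_toZModPow, RingHom.mem_ker]
  -- The isometry makes f injective modulo p^n on 0, …, p^n - 1, hence surjective onto residues by
  -- counting.
  let g : Fin (p ^ n) → ZMod (p ^ n) := fun t => PadicInt.toZModPow n (f t)
  have hle : ∀ s t : Fin (p ^ n), s ≤ t → g s = g t → s = t := by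
    intro s t hst h
    have h1 : (t : ℕ) = s + (t - s : ℕ) := by have : (s : ℕ) ≤ t := hst; omega
    have h2 : ‖f t - f s‖ ≤ (p : ℝ) ^ (-n : ℤ) := by
      rw [← key, map_sub, sub_eq_zero]; exact h.symm
    rw [h1, hf, ← key, map_natCast, ZMod.natCast_eq_zero_iff] at h2
    have h3 : (t - s : ℕ) = 0 := Nat.eq_zero_of_dvd_of_lt h2 (by omega)
    ext; omega
  have hinj : Function.Injective g := fun s t h => by
    rcases le_total s t with hst | hst
    · exact hle s t hst h
    · exact (hle t s hst h.symm).symm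
  have : NeZero (p ^ n) := ⟨pow_ne_zero _ (Fact.out : p.Prime).ne_zero⟩
  have hsurj : Function.Surjective g :=
    ((Fintype.bijective_iff_injective_and_card g).mpr ⟨hinj, by simp [ZMod.card]⟩).2
  obtain ⟨t, ht⟩ := hsurj (PadicInt.toZModPow n r)
  exact ⟨t, by rw [← key, map_sub, sub_eq_zero]; exact ht⟩

theorem exists_norm_powCoeff_ratio_sub_le (hτ : (p : ℤ_[p]) ^ 2 ∣ τ) (hδ : (p : ℤ_[p]) ^ 2 ∣ δ)
    (r : ℤ_[p]) (n : ℕ) :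
    ∃ t : ℕ, ‖Ring.inverse (powCoeff τ δ t).1 * (powCoeff τ δ t).2 - r‖ ≤ (p : ℝ) ^ (-n : ℤ) := by
  refine exists_norm_sub_le_of_isometry
    (f := fun t => Ring.inverse (powCoeff τ δ t).1 * (powCoeff τ δ t).2) (fun s t => ?_) r n
  have hu : ∀ t, IsUnit (powCoeff τ δ t).1 := fun t =>
    PadicInt.isUnit_iff.mpr (norm_powCoeff_fst hδ t)
  -- The last factor is the determinant of (1 + D)^s, a unit; so the two ratios differ by β_t up to
  -- units.
  have h1 : (powCoeff τ δ s).1 * (powCoeff τ δ (s + t)).1 *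
      (Ring.inverse (powCoeff τ δ (s + t)).1 * (powCoeff τ δ (s + t)).2 -
        Ring.inverse (powCoeff τ δ s).1 * (powCoeff τ δ s).2) =
      (powCoeff τ δ t).2 * ((powCoeff τ δ s).1 ^ 2 + τ * (powCoeff τ δ s).1 * (powCoeff τ δ s).2 +
        δ * (powCoeff τ δ s).2 ^ 2) := by
    have e1 := Ring.mul_inverse_cancel _ (hu s)
    have e2 := Ring.mul_inverse_cancel _ (hu (s + t))
    have e3 := powCoeff_add τ δ s t
    linear_combination (powCoeff τ δ s).1 * (powCoeff τ δ (s + t)).2 * e2 -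
      (powCoeff τ δ (s + t)).1 * (powCoeff τ δ s).2 * e1 + (powCoeff τ δ s).1 * e3.2 -
      (powCoeff τ δ s).2 * e3.1
  have h2 : ‖(powCoeff τ δ s).1 ^ 2 + τ * (powCoeff τ δ s).1 * (powCoeff τ δ s).2 +
        δ * (powCoeff τ δ s).2 ^ 2‖ = 1 := by
    rw [norm_eq_norm_of_sq_dvd_sub (y := (powCoeff τ δ s).1 ^ 2), norm_pow, norm_powCoeff_fst hδ,
      one_pow]
    · rw [add_assoc, add_sub_cancel_left]
      exact dvd_add ((hτ.mul_right _).mul_right _) (hδ.mul_right _)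
    · rw [norm_pow, norm_powCoeff_fst hδ, one_pow]
      exact inv_le_one_of_one_le₀ (mod_cast (Fact.out : p.Prime).one_lt.le)
  have h3 := congrArg norm h1
  rwa [norm_mul, norm_mul, norm_mul, norm_powCoeff_fst hδ, norm_powCoeff_fst hδ, h2,
    norm_powCoeff_snd hτ hδ, one_mul, one_mul, mul_one] at h3

/-- A closed cone containing the orbit of `v` under the powers of a matrix `1 + D` with `D`
divisible by `p ^ 2` contains the disc of all `v + r D v` with `r` in `ℤ_p`. -/
theorem add_smul_mem_of_isClosed {S : Set (Fin 2 → ℚ_[p])} (hS : IsClosed S)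
    (hcone : ∀ (c : ℚ_[p]) (u), u ∈ S → c • u ∈ S) (hτ : (p : ℤ_[p]) ^ 2 ∣ τ)
    (hδ : (p : ℤ_[p]) ^ 2 ∣ δ) {v d : Fin 2 → ℚ_[p]}
    (h : ∀ t, ((powCoeff τ δ t).1 : ℚ_[p]) • v + ((powCoeff τ δ t).2 : ℚ_[p]) • d ∈ S)
    (r : ℤ_[p]) : v + (r : ℚ_[p]) • d ∈ S := by
  choose t ht using exists_norm_powCoeff_ratio_sub_le hτ hδ r
  have hlim : Tendsto (fun n => Ring.inverse (powCoeff τ δ (t n)).1 * (powCoeff τ δ (t n)).2)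
      atTop (𝓝 r) := by
    rw [tendsto_iff_norm_sub_tendsto_zero]
    refine squeeze_zero (fun _ => norm_nonneg _) ht ?_
    simpa [← inv_pow] using tendsto_pow_atTop_nhds_zero_of_lt_one (inv_nonneg.mpr p.cast_nonneg)
      (inv_lt_one_of_one_lt₀ (show (1 : ℝ) < p from mod_cast (Fact.out : p.Prime).one_lt))
  have hcont : Continuous fun z : ℤ_[p] => v + (z : ℚ_[p]) • d :=
    continuous_const.add (continuous_subtype_val.smul continuous_const)
  refine hS.mem_of_tendsto ((hcont.tendsto r).comp hlim) (Eventually.of_forall fun n => ?_)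
  have hu : IsUnit (powCoeff τ δ (t n)).1 := PadicInt.isUnit_iff.mpr (norm_powCoeff_fst hδ (t n))
  -- The cone property permits division by the unit α_t.
  have h1 := hcone (Ring.inverse (powCoeff τ δ (t n)).1 : ℤ_[p]) _ (h (t n))
  rwa [smul_add, smul_smul, smul_smul, ← PadicInt.coe_mul, Ring.inverse_mul_cancel _ hu,
    PadicInt.coe_one, one_smul, ← PadicInt.coe_mul] at h1

/-! ### The cone of badly approximable vectors. -/

/-- The cone over `PBadEps`. -/
def badCone (p : ℕ) [Fact p.Prime] (ε : ℝ) : Set (Fin 2 → ℚ_[p]) :=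
  {v | ∀ a b : ℤ, (a, b) ≠ (0, 0) → ε * max ‖v 0‖ ‖v 1‖ ≤
    ‖(a : ℚ_[p]) * v 0 + (b : ℚ_[p]) * v 1‖ * max |(a : ℝ)| |(b : ℝ)| ^ 2}

theorem isClosed_badCone (ε : ℝ) : IsClosed (badCone p ε) := by
  simp only [badCone, Set.ofPred_forall]
  refine isClosed_iInter fun a => isClosed_iInter fun b => isClosed_iInter fun _ => ?_
  exact isClosed_le (by fun_prop) (by fun_prop)

theorem smul_mem_badCone {ε : ℝ} (c : ℚ_[p]) (u : Fin 2 → ℚ_[p]) (hu : u ∈ badCone p ε) :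
    c • u ∈ badCone p ε := by
  intro a b hab
  have h := mul_le_mul_of_nonneg_left (hu a b hab) (norm_nonneg c)
  have e : (a : ℚ_[p]) * (c • u) 0 + (b : ℚ_[p]) * (c • u) 1 = c * (a * u 0 + b * u 1) := by
    simp only [Pi.smul_apply, smul_eq_mul]; ring
  rw [e]
  simp only [Pi.smul_apply, smul_eq_mul, norm_mul]
  rw [← mul_max_of_nonneg _ _ (norm_nonneg c)]
  linarith

theorem eq_zero_of_mem_badCone {ε : ℝ} (hε : 0 < ε) {u : Fin 2 → ℚ_[p]} (hu : u ∈ badCone p ε)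
    {a b : ℤ} (hab : (a, b) ≠ (0, 0)) (h : (a : ℚ_[p]) * u 0 + (b : ℚ_[p]) * u 1 = 0) :
    u = 0 := by
  have h1 := hu a b hab
  rw [h, norm_zero, zero_mul] at h1
  have h2 : max ‖u 0‖ ‖u 1‖ ≤ 0 := by
    by_contra! h3
    exact absurd h1 (not_le.mpr (mul_pos hε h3))
  ext i
  fin_cases i
  · exact norm_le_zero_iff.mp ((le_max_left _ _).trans h2)
  · exact norm_le_zero_iff.mp ((le_max_right _ _).trans h2)

/-- Scaling by a power of p moves v into ℤ_p², where integer pairs are dense. -/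
theorem exists_intCast_near (v : Fin 2 → ℚ_[p]) (U : Set (ℚ_[p] × ℚ_[p])) (hU : IsOpen U)
    (hcone : ∀ c : ℚ_[p], c ≠ 0 → ∀ z ∈ U, c • z ∈ U) (hv : (v 0, v 1) ∈ U) :
    ∃ a b : ℤ, ((a : ℚ_[p]), (b : ℚ_[p])) ∈ U := by
  obtain ⟨n, hn⟩ : ∃ n : ℕ, max ‖v 0‖ ‖v 1‖ ≤ (p : ℝ) ^ n :=
    ((tendsto_pow_atTop_atTop_of_one_lt (show (1 : ℝ) < p from
      mod_cast (Fact.out : p.Prime).one_lt)).eventually_ge_atTop _).exists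
  have hp0 : (p : ℚ_[p]) ^ n ≠ 0 :=
    pow_ne_zero _ (Nat.cast_ne_zero.mpr (Fact.out : p.Prime).ne_zero)
  have hpos : (0 : ℝ) < (p : ℝ) ^ n := by
    have := (Fact.out : p.Prime).pos
    positivity
  have hle : ∀ i, ‖v i‖ ≤ (p : ℝ) ^ n → ‖(p : ℚ_[p]) ^ n * v i‖ ≤ 1 := fun i hi => by
    rw [norm_mul, norm_pow, Padic.norm_p, inv_pow, inv_mul_le_one₀ hpos]
    exact hi
  let z : ℤ_[p] × ℤ_[p] := (⟨_, hle 0 ((le_max_left _ _).trans hn)⟩,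
    ⟨_, hle 1 ((le_max_right _ _).trans hn)⟩)
  have hd : DenseRange (Prod.map (Int.cast : ℤ → ℤ_[p]) (Int.cast : ℤ → ℤ_[p])) :=
    PadicInt.denseRange_intCast.prodMap PadicInt.denseRange_intCast
  have hc : Continuous fun z : ℤ_[p] × ℤ_[p] => ((z.1 : ℚ_[p]), (z.2 : ℚ_[p])) :=
    (continuous_subtype_val.comp continuous_fst).prodMk (continuous_subtype_val.comp continuous_snd)
  obtain ⟨⟨a, b⟩, hab⟩ := hd.exists_mem_open (hU.preimage hc)
    ⟨z, hcone _ hp0 _ hv⟩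
  exact ⟨a, b, by simpa using hab⟩

/-- A disc of `ℚ_p`-points of the cone is contained in a line through the origin. -/
theorem mul_eq_mul_of_add_smul_mem_badCone {ε : ℝ} (hε : 0 < ε) {v d : Fin 2 → ℚ_[p]}
    (h : ∀ r : ℤ_[p], v + (r : ℚ_[p]) • d ∈ badCone p ε) : v 0 * d 1 = v 1 * d 0 := by
  by_contra hne
  -- The form with coefficients (v 1, -v 0) kills v but not d. A nearby direction gives an integral
  -- form smaller at v than at d, so the r at which it kills v + r d lies in ℤ_p.
  obtain ⟨a, b, hab⟩ := exists_intCast_near ![v 1, -v 0]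
    {z : ℚ_[p] × ℚ_[p] | ‖z.1 * v 0 + z.2 * v 1‖ < ‖z.1 * d 0 + z.2 * d 1‖}
    (isOpen_lt (by fun_prop) (by fun_prop))
    (fun c hc z hz => by
      have e : ∀ u : Fin 2 → ℚ_[p], ‖(c • z).1 * u 0 + (c • z).2 * u 1‖ =
          ‖c‖ * ‖z.1 * u 0 + z.2 * u 1‖ := fun u => by
        rw [← norm_mul]; congr 1; simp only [Prod.smul_fst, Prod.smul_snd, smul_eq_mul]; ring
      rw [Set.mem_ofPred_eq, e, e]
      exact mul_lt_mul_of_pos_left hz (norm_pos_iff.mpr hc))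
    (by
      change ‖v 1 * v 0 + -v 0 * v 1‖ < ‖v 1 * d 0 + -v 0 * d 1‖
      have : v 1 * v 0 + -v 0 * v 1 = 0 := by ring
      rw [this, norm_zero, norm_pos_iff]
      intro h0
      exact hne (by linear_combination -h0))
  change ‖(a : ℚ_[p]) * v 0 + b * v 1‖ < ‖(a : ℚ_[p]) * d 0 + b * d 1‖ at hab
  have hd : (a : ℚ_[p]) * d 0 + b * d 1 ≠ 0 := norm_pos_iff.mp ((norm_nonneg _).trans_lt hab)
  have hr : ‖-((a : ℚ_[p]) * v 0 + b * v 1) / (a * d 0 + b * d 1)‖ ≤ 1 := by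
    rw [norm_div, norm_neg]
    exact div_le_one_of_le₀ hab.le (norm_nonneg _)
  have hz := eq_zero_of_mem_badCone hε (h ⟨_, hr⟩) (a := a) (b := b)
    (by rintro h0; simp only [Prod.mk.injEq] at h0; simp [h0] at hd)
    (by simp only [Pi.add_apply, Pi.smul_apply, smul_eq_mul]; field_simp; ring)
  have h0 := congrFun hz 0
  have h1 := congrFun hz 1
  simp only [Pi.add_apply, Pi.smul_apply, smul_eq_mul, Pi.zero_apply] at h0 h1
  exact hne (by linear_combination d 1 * h0 - d 0 * h1)

end

/-! ### Prefix matrices, their limits, and the orbit of x. -/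

theorem wordMat_append (u v : List ℕ) : wordMat (u ++ v) = wordMat u * wordMat v := by
  simp [wordMat]

theorem wordPrefix_add (w : ℕ → ℕ) (m n : ℕ) :
    wordPrefix w (m + n) = wordPrefix w m ++ wordPrefix (shift m w) n := by
  simp [wordPrefix, List.range_add, shift, Function.comp_def]

theorem wordPrefix_eq_iff {u w : ℕ → ℕ} {n : ℕ} :
    wordPrefix u n = wordPrefix w n ↔ ∀ i < n, u i = w i := by
  simp [wordPrefix]

/-- If w reads its own prefix of length m + n from position l on, then its prefix of length l + m is
the concatenation of those of lengths l and m, and from position l + m on it reads its prefix of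
length n. -/
theorem mul_mem_V {w : ℕ → ℕ} {n m : ℕ} {M : Matrix (Fin 2) (Fin 2) ℤ}
    (hm : wordPrefix (shift m w) n = wordPrefix w n) (hM : M ∈ V (m + n) w) :
    M * wordMat (wordPrefix w m) ∈ V n w := by
  obtain ⟨l, hl, rfl⟩ := hM
  rw [wordPrefix_eq_iff] at hm hl
  refine ⟨l + m, wordPrefix_eq_iff.mpr fun i hi => ?_, ?_⟩
  · rw [← hm i hi]
    have := hl (m + i) (by omega)
    simpa [shift, add_assoc] using this
  · rw [wordPrefix_add, wordMat_append]
    congr 2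
    exact (wordPrefix_eq_iff.mpr fun i hi => hl i (by omega)).symm

section

variable {p : ℕ} [Fact p.Prime] {A : Matrix (Fin 2) (Fin 2) ℤ_[p]} {w : ℕ → ℕ}

theorem coeRingHom_apply (z : ℤ_[p]) : PadicInt.Coe.ringHom z = (z : ℚ_[p]) := rfl

/-- For B the prefix matrix of length m, approximate A within level m + n; then pass to limits in B.
As m is unbounded, A must lie in the closures of all levels. -/
theorem mul_mem_closure_VpLevel {B : Matrix (Fin 2) (Fin 2) ℤ_[p]} (hA : A ∈ Vp p w) {n : ℕ}
    (hn : 1 ≤ n) (hB : B ∈ closure (VpLevel p n w)) : A * B ∈ closure (VpLevel p n w) := by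
  have hA' : ∀ m, 1 ≤ m → A ∈ closure (VpLevel p m w) := fun m hm =>
    Set.mem_iInter₂.mp hA m hm
  have key : Set.MapsTo (fun B => A * B) (VpLevel p n w) (closure (VpLevel p n w)) := by
    rintro _ ⟨_, ⟨m, hm, rfl⟩, rfl⟩
    refine map_mem_closure (f := fun M => M *
      (wordMat (wordPrefix w m)).map (Int.cast : ℤ → ℤ_[p])) (by fun_prop)
      (hA' (m + n) (by omega)) ?_
    rintro _ ⟨M, hM, rfl⟩
    exact ⟨_, mul_mem_V hm hM, Matrix.map_mul (f := Int.castRingHom ℤ_[p])⟩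
  have := map_mem_closure (f := fun B => A * B) (by fun_prop) hB key
  rwa [closure_closure] at this

theorem pow_mem_closure_VpLevel (hA : A ∈ Vp p w) {n : ℕ} (hn : 1 ≤ n) (k : ℕ) :
    A ^ k ∈ closure (VpLevel p n w) := by
  induction k with
  | zero =>
    refine subset_closure ⟨1, ⟨0, ?_, ?_⟩, ?_⟩
    · rw [wordPrefix_eq_iff]; intro i _; simp [shift]
    · simp [wordMat, wordPrefix]
    · rw [pow_zero]; exact Matrix.map_one _ Int.cast_zero Int.cast_one
  | succ k ih => rw [pow_succ']; exact mul_mem_closure_VpLevel hA hn ih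

theorem transpose_letterMat (a : ℕ) : (letterMat a).transpose = letterMat a := by
  ext i j
  fin_cases i <;> fin_cases j <;> simp [letterMat]

/-- The letters act in the order opposite to the product in the prefix matrix. Since each letter
matrix is symmetric, this reversal is transposition, which is how Aᵀ enters. -/
theorem shiftPair_iterate (w : ℕ → ℕ) (x : Projectivization ℚ_[p] (Fin 2 → ℚ_[p])) (n : ℕ) :
    ((shiftPair p)^[n] (w, x)).1 = shift n w ∧
      ∃ h : ((wordMat (wordPrefix w n)).transpose.map (Int.cast : ℤ → ℚ_[p])).mulVec x.rep ≠ 0,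
        ((shiftPair p)^[n] (w, x)).2 = Projectivization.mk ℚ_[p] _ h := by
  induction n with
  | zero =>
    have h1 : ((wordMat (wordPrefix w 0)).transpose.map (Int.cast : ℤ → ℚ_[p])).mulVec x.rep
        = x.rep := by
      simp [wordMat, wordPrefix]
    refine ⟨by funext i; simp [shift], by rw [h1]; exact x.rep_nonzero, ?_⟩
    simp only [h1, Function.iterate_zero, id, Projectivization.mk_rep]
  | succ n ih =>
    obtain ⟨h1, h, h2⟩ := ih
    have e : ((wordMat (wordPrefix w (n + 1))).transpose.map (Int.cast : ℤ → ℚ_[p])).mulVec x.rep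
        = ((letterMat (w n)).map (Int.cast : ℤ → ℚ_[p])).mulVec
          (((wordMat (wordPrefix w n)).transpose.map (Int.cast : ℤ → ℚ_[p])).mulVec x.rep) := by
      have hw : wordMat (wordPrefix w (n + 1)) = wordMat (wordPrefix w n) * letterMat (w n) := by
        rw [wordPrefix_add, wordMat_append]
        simp [wordMat, wordPrefix, shift]
      rw [hw, Matrix.transpose_mul, transpose_letterMat, Matrix.mulVec_mulVec]
      congr 1
      exact Matrix.map_mul (f := Int.castRingHom ℚ_[p])
    have hne : ((letterMat (w n)).map (Int.cast : ℤ → ℚ_[p])).mulVec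
        (((wordMat (wordPrefix w n)).transpose.map (Int.cast : ℤ → ℚ_[p])).mulVec x.rep) ≠ 0 :=
      fun h0 => h (letterMat_injective p (w n) (h0.trans (map_zero _).symm))
    rw [Function.iterate_succ_apply', shiftPair, h1, h2]
    refine ⟨by funext i; simp [shift, add_assoc], by rw [e]; exact hne, ?_⟩
    simp only [e, letterAct, shift, add_zero]
    exact Projectivization.map_mk _ _ _ _

theorem mulVec_mem_badCone {ε : ℝ} {x : Projectivization ℚ_[p] (Fin 2 → ℚ_[p])}
    (hx : (w, x) ∈ LMadEps p ε) (n : ℕ) :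
    ((wordMat (wordPrefix w n)).transpose.map (Int.cast : ℤ → ℚ_[p])).mulVec x.rep
      ∈ badCone p ε := by
  obtain ⟨-, h, h2⟩ := shiftPair_iterate w x n
  have := (hx n).2
  rw [h2] at this
  exact (mk_mem_PBadEps p ε _ h).mp this

theorem pow_mulVec_mem_badCone {ε : ℝ} {x : Projectivization ℚ_[p] (Fin 2 → ℚ_[p])}
    (hx : (w, x) ∈ LMadEps p ε) (hA : A ∈ Vp p w) (k : ℕ) :
    ((A.transpose ^ k).map PadicInt.Coe.ringHom).mulVec x.rep ∈ badCone p ε := by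
  rw [← Matrix.transpose_pow]
  have hc : Continuous fun z : ℤ_[p] => PadicInt.Coe.ringHom z := continuous_subtype_val
  have hcont : Continuous fun M : Matrix (Fin 2) (Fin 2) ℤ_[p] =>
      (M.transpose.map PadicInt.Coe.ringHom).mulVec x.rep :=
    (continuous_id.matrix_transpose.matrix_map hc).matrix_mulVec continuous_const
  have := map_mem_closure hcont (pow_mem_closure_VpLevel hA le_rfl k)
    (t := badCone p ε) (by
      rintro _ ⟨_, ⟨m, -, rfl⟩, rfl⟩
      convert mulVec_mem_badCone hx m using 2
      ext i j
      simp)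
  rwa [(isClosed_badCone ε).closure_eq] at this

/-! ### From a power of A back to A. -/

/-- The reduction of A modulo p^q is an element of a finite unit group. -/
theorem exists_pow_eq_one_add (hA : IsUnit A.det) (q : ℕ) :
    ∃ k : ℕ, 0 < k ∧ ∃ D : Matrix (Fin 2) (Fin 2) ℤ_[p],
      A ^ k = 1 + D ∧ ∀ i j, (p : ℤ_[p]) ^ q ∣ D i j := by
  have : NeZero (p ^ q) := ⟨pow_ne_zero _ (Fact.out : p.Prime).ne_zero⟩
  obtain ⟨u, hu⟩ := ((Matrix.isUnit_iff_isUnit_det A).mpr hA).map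
    (PadicInt.toZModPow (p := p) q).mapMatrix
  obtain ⟨k, hk, h1⟩ := isOfFinOrder_iff_pow_eq_one.mp (isOfFinOrder_of_finite u)
  refine ⟨k, hk, A ^ k - 1, by abel, fun i j => ?_⟩
  have h2 : (PadicInt.toZModPow (p := p) q).mapMatrix (A ^ k - 1) = 0 := by
    rw [map_sub, map_pow, map_one, ← hu, ← Units.val_pow_eq_pow_val, h1, Units.val_one, sub_self]
  have h3 : PadicInt.toZModPow q ((A ^ k - 1) i j) = 0 := congrFun (congrFun h2 i) j
  rwa [← RingHom.mem_ker, PadicInt.ker_toZModPow, Ideal.mem_span_singleton] at h3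

/-- `v` and `M v` are proportional, for some positive power `M` of the transpose of `A`. -/
theorem exists_pow_mulVec_proportional {x : Projectivization ℚ_[p] (Fin 2 → ℚ_[p])}
    (hx : (w, x) ∈ LMad p) (hA : A ∈ Vp p w) (hdet : IsUnit A.det) :
    ∃ k : ℕ, 0 < k ∧
      x.rep 0 * ((A.transpose ^ k).map PadicInt.Coe.ringHom).mulVec x.rep 1 =
      x.rep 1 * ((A.transpose ^ k).map PadicInt.Coe.ringHom).mulVec x.rep 0 := by
  obtain ⟨ε, hε, hx⟩ := hx
  obtain ⟨k, hk, D, hD, hdvd⟩ := exists_pow_eq_one_add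
    (A := A.transpose) (by rwa [Matrix.det_transpose]) 2
  refine ⟨k, hk, ?_⟩
  have hτ : (p : ℤ_[p]) ^ 2 ∣ D.trace := by
    rw [Matrix.trace_fin_two]; exact dvd_add (hdvd _ _) (hdvd _ _)
  have hδ : (p : ℤ_[p]) ^ 2 ∣ D.det := by
    rw [Matrix.det_fin_two]; exact dvd_sub ((hdvd _ _).mul_right _) ((hdvd _ _).mul_right _)
  have h := mul_eq_mul_of_add_smul_mem_badCone hε (v := x.rep)
    (d := (D.map PadicInt.Coe.ringHom).mulVec x.rep)
    (add_smul_mem_of_isClosed (isClosed_badCone ε) smul_mem_badCone hτ hδ fun t => by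
      have := pow_mulVec_mem_badCone hx hA (k * t)
      rw [pow_mul, hD, one_add_pow_eq] at this
      convert this using 1
      ext i
      fin_cases i <;>
        simp [Matrix.mulVec, dotProduct, Fin.sum_univ_two, coeRingHom_apply] <;> ring)
  rw [hD]
  simp only [Matrix.mulVec, dotProduct, Fin.sum_univ_two, Matrix.map_apply, Matrix.add_apply,
    map_add, Matrix.one_apply_eq, map_one] at h ⊢
  simp
  linear_combination h

theorem pow_eq_add_smul {R : Type*} [CommRing R] (A : Matrix (Fin 2) (Fin 2) R) (k : ℕ) :
    ∃ a b : R, A ^ k = a • 1 + b • A := by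
  induction k with
  | zero => exact ⟨1, 0, by simp⟩
  | succ k ih =>
    obtain ⟨a, b, h⟩ := ih
    refine ⟨-(b * A.det), a + b * A.trace, ?_⟩
    rw [pow_succ, h, add_mul, smul_mul_assoc, one_mul, smul_mul_assoc, sq_eq_trace_smul_sub_det]
    module

theorem toAlgCl_eq_mapMatrix (A : Matrix (Fin 2) (Fin 2) ℤ_[p]) : toAlgCl p A =
    ((algebraMap ℚ_[p] (PadicAlgCl p)).comp PadicInt.Coe.ringHom).mapMatrix A := rfl

theorem pow_mulVec_of_mulVec_eq {K : Type*} [Field K] {M : Matrix (Fin 2) (Fin 2) K}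
    {v : Fin 2 → K} {μ : K} (h : M.mulVec v = μ • v) (k : ℕ) : (M ^ k).mulVec v = μ ^ k • v := by
  induction k with
  | zero => simp
  | succ k ih => rw [pow_succ', ← Matrix.mulVec_mulVec, ih, Matrix.mulVec_smul, h, smul_smul,
      ← pow_succ]

theorem det_sq_eq_one (hA : A ∈ SLpm p) : A.det ^ 2 = 1 := by
  rcases hA with h | h <;> rw [h] <;> norm_num

/-- No positive power of a matrix in `SLtilde` is scalar. -/
theorem pow_ne_smul_one (hA : A ∈ SLtilde p) {k : ℕ} (hk : 0 < k) (s : ℤ_[p]) :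
    A ^ k ≠ s • 1 := by
  intro hs
  obtain ⟨⟨hdet, v, -, -, ⟨μ, hμ⟩, -⟩, hlog⟩ := hA
  -- Determinants give s² = (det A)^k with det A = ±1.
  have hs4 : s ^ 4 = 1 := by
    have h := congrArg Matrix.det hs
    rw [Matrix.det_pow, Matrix.det_smul, Matrix.det_one, mul_one, Fintype.card_fin] at h
    calc s ^ 4 = (s ^ 2) ^ 2 := by ring
      _ = (A.det ^ 2) ^ k := by rw [← h]; ring
      _ = 1 := by rw [det_sq_eq_one hdet, one_pow]
  have heig : Module.End.HasEigenvalue (Matrix.toLin' (toAlgCl p A)) μ :=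
    Module.End.hasEigenvalue_of_hasEigenvector (x := v.rep)
      ⟨Module.End.mem_eigenspace_iff.mpr (by rw [Matrix.toLin'_apply, hμ]), v.rep_nonzero⟩
  have hμk : μ ^ k = algebraMap ℚ_[p] (PadicAlgCl p) (s : ℚ_[p]) := by
    have h1 := pow_mulVec_of_mulVec_eq hμ k
    have h2 : toAlgCl p A ^ k = (algebraMap ℚ_[p] (PadicAlgCl p) (s : ℚ_[p])) • 1 := by
      rw [toAlgCl_eq_mapMatrix, ← map_pow, hs]
      ext i j
      fin_cases i <;> fin_cases j <;> simp [coeRingHom_apply]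
    rw [h2, Matrix.smul_mulVec, Matrix.one_mulVec] at h1
    exact (smul_left_injective _ v.rep_nonzero h1).symm
  have hμ4 : (μ ^ kappa p A) ^ (k * 4) = 1 := by
    rw [← pow_mul, mul_comm, pow_mul, pow_mul, hμk, ← map_pow, ← PadicInt.coe_pow, hs4]
    simp
  refine hlog μ heig (padicLog_eq_zero_of_pow_eq_one p _ (by omega) hμ4 ?_)
  -- If no exponent qualified, `kappa` would have the default value 0 and μ^0 - 1 = 0 would satisfy
  -- the bound anyway.
  rcases Set.eq_empty_or_nonempty {k : ℕ | 0 < k ∧ ∀ μ : PadicAlgCl p,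
    Module.End.HasEigenvalue (Matrix.toLin' (toAlgCl p A)) μ → ‖μ ^ k - 1‖ ≤ (p : ℝ)⁻¹} with h | h
  · have : kappa p A = 0 := by rw [kappa, h, Nat.sInf_empty]
    simp [this]
  · exact (Nat.sInf_mem h).2 μ heig

theorem isUnit_det_of_mem_SLpm (hA : A ∈ SLpm p) : IsUnit A.det := by
  rcases hA with h | h <;> rw [h]
  · exact isUnit_one
  · exact isUnit_one.neg

theorem mulVec_proportional {x : Projectivization ℚ_[p] (Fin 2 → ℚ_[p])} (hA : A ∈ SLtilde p)
    (hV : A ∈ Vp p w) (hx : (w, x) ∈ LMad p) :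
    x.rep 0 * (A.transpose.map PadicInt.Coe.ringHom).mulVec x.rep 1 =
      x.rep 1 * (A.transpose.map PadicInt.Coe.ringHom).mulVec x.rep 0 := by
  obtain ⟨k, hk, h⟩ := exists_pow_mulVec_proportional hx hV (isUnit_det_of_mem_SLpm hA.1.1)
  obtain ⟨a, b, hab⟩ := pow_eq_add_smul A k
  have hb : (b : ℚ_[p]) ≠ 0 := fun hb => by
    rw [PadicInt.coe_eq_zero] at hb
    exact pow_ne_smul_one hA hk a (by rw [hab, hb, zero_smul, add_zero])
  rw [← Matrix.transpose_pow, hab] at h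
  simp [Matrix.mulVec, dotProduct, Fin.sum_univ_two, coeRingHom_apply] at h ⊢
  apply mul_left_cancel₀ hb
  linear_combination h

end

/-! ### Eigenpoints in the plane over a field. -/

section

variable {K : Type*} [Field K] {M : Matrix (Fin 2) (Fin 2) K}

/-- Rotation by a right angle. -/
def rot (v : Fin 2 → K) : Fin 2 → K := ![v 1, -v 0]

theorem rot_ne_zero {v : Fin 2 → K} (hv : v ≠ 0) : rot v ≠ 0 := by
  contrapose! hv
  ext i
  fin_cases i
  · simpa [rot] using congrFun hv 1
  · simpa [rot] using congrFun hv 0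

theorem mk_eq_mk_iff_mul_eq {u v : Fin 2 → K} (hu : u ≠ 0) (hv : v ≠ 0) :
    Projectivization.mk K u hu = Projectivization.mk K v hv ↔ u 0 * v 1 = u 1 * v 0 := by
  rw [Projectivization.mk_eq_mk_iff']
  constructor
  · rintro ⟨a, rfl⟩
    simp only [Pi.smul_apply, smul_eq_mul]; ring
  · intro h
    by_cases h0 : v 0 = 0
    · have h1 : v 1 ≠ 0 := fun h1 => hv (by ext i; fin_cases i <;> assumption)
      refine ⟨u 1 / v 1, ?_⟩
      ext i
      fin_cases i
      · have : u 0 = 0 := by simpa [h0, h1] using h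
        simp [h0, this]
      · simp [h1]
    · refine ⟨u 0 / v 0, ?_⟩
      ext i
      fin_cases i
      · simp [h0]
      · simp only [Fin.mk_one, Pi.smul_apply, smul_eq_mul]
        field_simp
        linear_combination h

theorem isEigenpoint_mk_iff_mul_eq {v : Fin 2 → K} (hv : v ≠ 0) :
    IsEigenpoint M (Projectivization.mk K v hv) ↔
      v 0 * M.mulVec v 1 = v 1 * M.mulVec v 0 := by
  rw [isEigenpoint_mk]
  constructor
  · rintro ⟨μ, h⟩
    rw [h]; simp only [Pi.smul_apply, smul_eq_mul]; ring
  · intro h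
    by_cases hM : M.mulVec v = 0
    · exact ⟨0, by simpa using hM⟩
    · obtain ⟨a, ha⟩ := (Projectivization.mk_eq_mk_iff' K _ _ hM hv).mp
        ((mk_eq_mk_iff_mul_eq hM hv).mpr (by linear_combination -h))
      exact ⟨a, ha.symm⟩

/-- With J the rotation, Mᵀ J = J adj(M), and adj(M) = tr(M) - M has every eigenvector of M. -/
theorem isEigenpoint_transpose_rot {v : Fin 2 → K} (hv : v ≠ 0)
    (h : IsEigenpoint M (Projectivization.mk K v hv)) :
    IsEigenpoint M.transpose (Projectivization.mk K (rot v) (rot_ne_zero hv)) := by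
  rw [isEigenpoint_mk_iff_mul_eq] at h ⊢
  simp [Matrix.mulVec, dotProduct, Fin.sum_univ_two, rot] at h ⊢
  linear_combination -h

/-- A matrix with three different eigenpoints is scalar. -/
theorem scalar_of_three_eigenpoints {u v z : Fin 2 → K} (huv : u 0 * v 1 ≠ u 1 * v 0)
    (huz : u 0 * z 1 ≠ u 1 * z 0) (hvz : v 0 * z 1 ≠ v 1 * z 0)
    (hu : ∃ μ : K, M.mulVec u = μ • u) (hv : ∃ μ : K, M.mulVec v = μ • v)
    (hz : ∃ μ : K, M.mulVec z = μ • z) : M 0 1 = 0 ∧ M 1 0 = 0 ∧ M 0 0 = M 1 1 := by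
  -- Eigenvectors are zeros of a binary quadratic form. Three pairwise independent zeros force it to
  -- vanish; its coefficients are then isolated by Cramer's rule, with determinant d up to sign.
  have key : ∀ y : Fin 2 → K, (∃ μ : K, M.mulVec y = μ • y) →
      M 1 0 * y 0 ^ 2 + (M 1 1 - M 0 0) * (y 0 * y 1) - M 0 1 * y 1 ^ 2 = 0 := by
    rintro y ⟨μ, h⟩
    have h0 := congrFun h 0
    have h1 := congrFun h 1
    simp [Matrix.mulVec, dotProduct, Fin.sum_univ_two] at h0 h1
    linear_combination y 0 * h1 - y 1 * h0
  have hu := key u hu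
  have hv := key v hv
  have hz := key z hz
  have d : (u 0 * v 1 - u 1 * v 0) * (u 0 * z 1 - u 1 * z 0) * (v 0 * z 1 - v 1 * z 0) ≠ 0 :=
    mul_ne_zero (mul_ne_zero (sub_ne_zero.mpr huv) (sub_ne_zero.mpr huz)) (sub_ne_zero.mpr hvz)
  refine ⟨?_, ?_, ?_⟩
  · apply mul_left_cancel₀ d
    linear_combination (-(v 0 * z 0 * (v 0 * z 1 - v 1 * z 0))) * hu
      + (u 0 * z 0 * (u 0 * z 1 - u 1 * z 0)) * hv
      - (u 0 * v 0 * (u 0 * v 1 - u 1 * v 0)) * hz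
  · apply mul_left_cancel₀ d
    linear_combination ((v 1 * z 1 * (v 0 * z 1 - v 1 * z 0))) * hu
      - (u 1 * z 1 * (u 0 * z 1 - u 1 * z 0)) * hv
      + (u 1 * v 1 * (u 0 * v 1 - u 1 * v 0)) * hz
  · apply mul_left_cancel₀ d
    linear_combination ((v 0 * z 1 + v 1 * z 0) * (v 0 * z 1 - v 1 * z 0)) * hu
      - ((u 0 * z 1 + u 1 * z 0) * (u 0 * z 1 - u 1 * z 0)) * hv
      + ((u 0 * v 1 + u 1 * v 0) * (u 0 * v 1 - u 1 * v 0)) * hz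

end

/-! ### Irrationality, degree and the two candidates. -/

open Polynomial in
theorem isIntegral_and_natDegree_minpoly_le_two {F L : Type*} [Field F] [Field L] [Algebra F L]
    {a b c : F} {ξ : L} (h0 : a ≠ 0 ∨ b ≠ 0 ∨ c ≠ 0)
    (h : algebraMap F L a * ξ ^ 2 + algebraMap F L b * ξ + algebraMap F L c = 0) :
    IsIntegral F ξ ∧ (minpoly F ξ).natDegree ≤ 2 := by
  have hP : C a * X ^ 2 + C b * X + C c ≠ 0 := fun hP => by
    have h2 := congrArg (coeff · 2) hP
    have h1 := congrArg (coeff · 1) hP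
    have hc := congrArg (coeff · 0) hP
    simp [coeff_X, coeff_C] at h2 h1 hc
    rcases h0 with h0 | h0 | h0
    exacts [h0 h2, h0 h1, h0 hc]
  have hroot : aeval ξ (C a * X ^ 2 + C b * X + C c) = 0 := by simpa using h
  refine ⟨IsAlgebraic.isIntegral ⟨_, hP, hroot⟩, ?_⟩
  exact (natDegree_le_of_dvd (minpoly.dvd F ξ hroot) hP).trans natDegree_quadratic_le

variable {p : ℕ} [Fact p.Prime] {A : Matrix (Fin 2) (Fin 2) ℤ_[p]} {w : ℕ → ℕ}
  {x : Projectivization ℚ_[p] (Fin 2 → ℚ_[p])}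

theorem rep_mem_badCone (hx : (w, x) ∈ LMad p) : ∃ ε > 0, x.rep ∈ badCone p ε := by
  obtain ⟨ε, hε, hx⟩ := hx
  exact ⟨ε, hε, (hx 0).2⟩

theorem rep_one_ne_zero_of_mem_LMad (hx : (w, x) ∈ LMad p) : x.rep 1 ≠ 0 := by
  obtain ⟨ε, hε, h⟩ := rep_mem_badCone hx
  exact fun h1 => x.rep_nonzero
    (eq_zero_of_mem_badCone hε h (a := 0) (b := 1) (by simp) (by simp [h1]))

theorem affineCoord_ne_ratCast_of_mem_LMad (hx : (w, x) ∈ LMad p) (r : ℚ) :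
    affineCoord p x ≠ (r : ℚ_[p]) := by
  intro hr
  have h1 := rep_one_ne_zero_of_mem_LMad hx
  obtain ⟨ε, hε, h⟩ := rep_mem_badCone hx
  -- For ξ = num/den the integral form (den, -num) kills the representative.
  refine x.rep_nonzero (eq_zero_of_mem_badCone hε h (a := r.den) (b := -r.num) (by simp) ?_)
  rw [affineCoord, div_eq_iff h1] at hr
  have hd : (r.den : ℚ_[p]) ≠ 0 := Nat.cast_ne_zero.mpr r.den_ne_zero
  rw [hr, Rat.cast_def]
  push_cast
  field_simp
  ring

/-- This is the proportionality of v and Aᵀ v, divided by the square of the second coordinate of v.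
-/
theorem quadratic_eq_zero_of_mem_LMad (hA : A ∈ SLtilde p) (hV : A ∈ Vp p w)
    (hx : (w, x) ∈ LMad p) :
    (A 0 1 : ℚ_[p]) * affineCoord p x ^ 2 + ((A 1 1 : ℚ_[p]) - A 0 0) * affineCoord p x
      + -(A 1 0 : ℚ_[p]) = 0 := by
  have h := mulVec_proportional hA hV hx
  have h1 := rep_one_ne_zero_of_mem_LMad hx
  simp [Matrix.mulVec, dotProduct, Fin.sum_univ_two, coeRingHom_apply] at h
  rw [affineCoord]
  field_simp
  linear_combination h

theorem not_scalar_of_mem_SLtilde (hA : A ∈ SLtilde p) :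
    (A 0 1 : ℚ_[p]) ≠ 0 ∨ (A 1 1 : ℚ_[p]) - A 0 0 ≠ 0 ∨ -(A 1 0 : ℚ_[p]) ≠ 0 := by
  by_contra! h
  obtain ⟨h1, h2, h3⟩ := h
  rw [PadicInt.coe_eq_zero] at h1
  rw [neg_eq_zero, PadicInt.coe_eq_zero] at h3
  rw [← PadicInt.coe_sub, PadicInt.coe_eq_zero, sub_eq_zero] at h2
  refine pow_ne_smul_one hA one_pos (A 0 0) ?_
  ext i j
  fin_cases i <;> fin_cases j <;> simp [h1, h2, h3]

theorem planeToAlgCl_rep_ne_zero (x : Projectivization ℚ_[p] (Fin 2 → ℚ_[p])) :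
    planeToAlgCl p x.rep ≠ 0 := fun h0 =>
  x.rep_nonzero (planeToAlgCl_injective p (h0.trans (map_zero _).symm))

theorem pointToAlgCl_eq_mk (x : Projectivization ℚ_[p] (Fin 2 → ℚ_[p])) :
    pointToAlgCl p x = Projectivization.mk _ _ (planeToAlgCl_rep_ne_zero x) := by
  conv_lhs => rw [← x.mk_rep]
  exact Projectivization.map_mk _ _ _ _

theorem pointToAlgCl_injective : Function.Injective (pointToAlgCl p) := by
  intro x y h
  rw [pointToAlgCl_eq_mk, pointToAlgCl_eq_mk, mk_eq_mk_iff_mul_eq] at h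
  rw [← x.mk_rep, ← y.mk_rep, mk_eq_mk_iff_mul_eq]
  apply (algebraMap ℚ_[p] (PadicAlgCl p)).injective
  rw [map_mul, map_mul]
  exact h

theorem isEigenpoint_pointToAlgCl (hA : A ∈ SLtilde p) (hV : A ∈ Vp p w)
    (hx : (w, x) ∈ LMad p) : IsEigenpoint (toAlgCl p A).transpose (pointToAlgCl p x) := by
  have h := congrArg (algebraMap ℚ_[p] (PadicAlgCl p)) (mulVec_proportional hA hV hx)
  rw [pointToAlgCl_eq_mk, isEigenpoint_mk_iff_mul_eq]
  simp [Matrix.mulVec, dotProduct, Fin.sum_univ_two, coeRingHom_apply, toAlgCl,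
    planeToAlgCl] at h ⊢
  exact h

/-- The transpose of a matrix in `SLtilde` has exactly two eigenpoints. -/
theorem exists_two_eigenpoints_transpose (hA : A ∈ SLtilde p) :
    ∃ w₁ w₂ : Projectivization (PadicAlgCl p) (Fin 2 → PadicAlgCl p), w₁ ≠ w₂ ∧
      ∀ v, IsEigenpoint (toAlgCl p A).transpose v ↔ v = w₁ ∨ v = w₂ := by
  obtain ⟨v₁, v₂, hne, h1, h2⟩ := hA.1.2
  rw [← v₁.mk_rep, ← v₂.mk_rep, Ne, mk_eq_mk_iff_mul_eq] at hne
  rw [← v₁.mk_rep] at h1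
  rw [← v₂.mk_rep] at h2
  have e1 := isEigenpoint_transpose_rot v₁.rep_nonzero h1
  have e2 := isEigenpoint_transpose_rot v₂.rep_nonzero h2
  have hne' : rot v₁.rep 0 * rot v₂.rep 1 ≠ rot v₁.rep 1 * rot v₂.rep 0 := by
    simp only [rot, Matrix.cons_val_zero, Matrix.cons_val_one]
    exact fun h => hne (by linear_combination h)
  refine ⟨_, _, fun h => hne' ((mk_eq_mk_iff_mul_eq (rot_ne_zero v₁.rep_nonzero)
    (rot_ne_zero v₂.rep_nonzero)).mp h), fun v => ⟨fun hv => ?_, ?_⟩⟩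
  -- A third eigenpoint would make Aᵀ scalar, hence A scalar, which is excluded by the case k = 1 of
  -- `pow_ne_smul_one`.
  · by_contra! hcon
    rw [← v.mk_rep] at hv
    obtain ⟨hc1, hc2⟩ := hcon
    rw [← v.mk_rep, Ne, mk_eq_mk_iff_mul_eq] at hc1 hc2
    rw [isEigenpoint_mk] at hv e1 e2
    obtain ⟨s1, s2, s3⟩ := scalar_of_three_eigenpoints hne'
      (fun h => hc1 (by linear_combination -h)) (fun h => hc2 (by linear_combination -h)) e1 e2 hv
    simp only [toAlgCl, Matrix.transpose_apply, Matrix.map_apply, map_eq_zero] at s1 s2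
    have s3 := (algebraMap ℚ_[p] (PadicAlgCl p)).injective s3
    rcases not_scalar_of_mem_SLtilde hA with h | h | h
    · exact h s2
    · exact h (sub_eq_zero.mpr s3.symm)
    · exact h (neg_eq_zero.mpr s1)
  · rintro (rfl | rfl)
    exacts [e1, e2]

end PadicLittlewood

theorem theorem6p3 (p : ℕ) [Fact p.Prime] (w : ℕ → ℕ) (A : Matrix (Fin 2) (Fin 2) ℤ_[p])
    (hA : A ∈ SLtilde p) (hV : A ∈ Vp p w) :
    -- `Aᵀ` has exactly two eigenvectors, and they are the only candidates for `x`
    (∃ w₁ w₂ : Projectivization (PadicAlgCl p) (Fin 2 → PadicAlgCl p),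
      w₁ ≠ w₂ ∧
      (∀ v, IsEigenpoint (toAlgCl p A).transpose v ↔ v = w₁ ∨ v = w₂) ∧
      ∀ x : Projectivization ℚ_[p] (Fin 2 → ℚ_[p]), (w, x) ∈ LMad p →
        pointToAlgCl p x = w₁ ∨ pointToAlgCl p x = w₂) ∧
    {x : Projectivization ℚ_[p] (Fin 2 → ℚ_[p]) | (w, x) ∈ LMad p}.encard ≤ 2 ∧
    -- `x = (ξ : 1)` with `ξ` irrational and at most quadratic over the field of the entries of `A`
    ∀ x : Projectivization ℚ_[p] (Fin 2 → ℚ_[p]), (w, x) ∈ LMad p →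
      x.rep 1 ≠ 0 ∧
      (∀ r : ℚ, affineCoord p x ≠ (r : ℚ_[p])) ∧
      IsIntegral (entryField p A) (affineCoord p x) ∧
      (minpoly (entryField p A) (affineCoord p x)).natDegree ≤ 2 ∧
      ((∀ i j, ∃ r : ℚ, (A i j : ℚ_[p]) = (r : ℚ_[p])) →
        IsIntegral ℚ (affineCoord p x) ∧ (minpoly ℚ (affineCoord p x)).natDegree = 2) := by
  obtain ⟨w₁, w₂, hne, hw⟩ := exists_two_eigenpoints_transpose hA
  have hmem : ∀ x : Projectivization ℚ_[p] (Fin 2 → ℚ_[p]), (w, x) ∈ LMad p →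
      pointToAlgCl p x = w₁ ∨ pointToAlgCl p x = w₂ := fun x hx =>
    (hw _).mp (isEigenpoint_pointToAlgCl hA hV hx)
  refine ⟨⟨w₁, w₂, hne, hw, hmem⟩, ?_, fun x hx => ?_⟩
  -- The eigenpoints may not be defined over ℚ_p, so the count takes place over the algebraic
  -- closure.
  · rw [← pointToAlgCl_injective.encard_image]
    refine (Set.encard_le_encard (t := {w₁, w₂}) ?_).trans (Set.encard_pair hne).le
    rintro _ ⟨x, hx, rfl⟩
    exact hmem x hx
  have hirr := affineCoord_ne_ratCast_of_mem_LMad hx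
  have hq := quadratic_eq_zero_of_mem_LMad hA hV hx
  have hns := not_scalar_of_mem_SLtilde hA
  have hF : IsIntegral (entryField p A) (affineCoord p x) ∧
      (minpoly (entryField p A) (affineCoord p x)).natDegree ≤ 2 := by
    let e : Fin 2 → Fin 2 → entryField p A := fun i j =>
      ⟨A i j, IntermediateField.subset_adjoin _ _ ⟨i, j, rfl⟩⟩
    refine isIntegral_and_natDegree_minpoly_le_two (a := e 0 1) (b := e 1 1 - e 0 0)
      (c := -e 1 0) ?_ hq
    refine hns.imp (fun h h0 => h (congrArg Subtype.val h0)) (Or.imp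
      (fun h h0 => h (congrArg Subtype.val h0)) (fun h h0 => h (congrArg Subtype.val h0)))
  refine ⟨rep_one_ne_zero_of_mem_LMad hx, hirr, hF.1, hF.2, fun hrat => ?_⟩
  choose e he using hrat
  simp only [he] at hq hns
  obtain ⟨hint, hdeg⟩ := isIntegral_and_natDegree_minpoly_le_two (F := ℚ) (ξ := affineCoord p x)
    (a := e 0 1) (b := e 1 1 - e 0 0) (c := -e 1 0) (by exact_mod_cast hns) (by simpa using hq)
  refine ⟨hint, ?_⟩
  have hpos := minpoly.natDegree_pos hint
  have hone : (minpoly ℚ (affineCoord p x)).natDegree ≠ 1 := fun h1 => by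
    obtain ⟨r, hr⟩ := minpoly.natDegree_eq_one_iff.mp h1
    exact hirr r (by rw [← hr]; simp)
  omega
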